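/- Let $\mathcal G$ be a finite connected graph (loops and multiple edges allowed, a loop counting twice in the degree) in which every vertex has degree $d\ge 2$. Let $a_\alpha>0$ ($\alpha\in E(\mathcal G)$) and $b_j\in\mathbb R$ ($j\in V(\mathcal G)$) be Jacobi parameters, and let $J=J(a,b)$ be the associated Jacobi matrix on $V(\mathcal G)$, $(Ju)_i=b_iu_i+\sum a_\alpha u_j$, where the sum is over all oriented edges $\alpha$ from $i$, and $j$ is the other end of $\alpha$ (so multiple edges add up and a loop at $i$ contributes $2a_\alpha u_i$). Let $\mathcal T$ be the universal cover of $\mathcal G$, i.e. the $d$-regular tree, and let $H$ be the lift of $J$, i.e. the bounded self-adjoint operator on $\ell^2(V(\mathcal T))$ given by the same formula with the parameters pulled back along the covering map. Let $\sigma(a,b)$ be the largest eigenvalue of $J$, let $\Sigma(a,b)=\sup\operatorname{spec}(H)$, and let $G(a,b)=\sigma(a,b)-\Sigma(a,b)$. Let $\psi$ be a strictly positive vector on $V(\mathcal G)$ with $J\psi=\sigma(a,b)\psi$ (it exists and is unique up to a positive factor by the Perron–Frobenius theorem). Put $$S=\sup_{\alpha=(i,j)\in E(\mathcal G)} a_\alpha\psi_i\psi_j,\qquad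 \tilde S=\sup_{\alpha=(i,j)\in E(\mathcal G)}\frac1{a_\alpha\psi_i\psi_j},\qquad I=\inf_{i\in V(\mathcal G)}\psi_i^2,\qquad \tilde I=\inf_{i\in V(\mathcal G)}\frac1{\psi_i^2},$$ where $\alpha=(i,j)$ means that $i,j$ are the two ends of $\alpha$. Then $$\frac{\tilde I}{\tilde S}\bigl(d-2\sqrt{d-1}\bigr)\;\le\; G(a,b)\;\le\;\frac SI\bigl(d-2\sqrt{d-1}\bigr).$$ -/

import Mathlib

open scoped Matrix

/-- A multigraph with vertex set `V` and edge set `E`; loops and multiple edges are allowed.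
`ends e` lists the two ends of the edge `e` in an arbitrary order (a reference orientation, on
which none of the quantities below depends in an essential way). -/
structure Multigraph (V E : Type*) where
  ends : E → V × V

namespace Multigraph

variable {V E : Type*}

/-- An oriented edge: an edge together with a direction. Every edge, loops included, carries
exactly two oriented edges. -/
abbrev Dart (_G : Multigraph V E) : Type _ := E × Bool

/-- The initial vertex of an oriented edge. -/
def src (G : Multigraph V E) : G.Dart → V
  | (e, true) => (G.ends e).1
  | (e, false) => (G.ends e).2

/-- The same edge with the opposite direction. -/
def rev (G : Multigraph V E) : G.Dart → G.Dart
  | (e, s) => (e, !s)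

/-- The terminal vertex of an oriented edge. -/
def tgt (G : Multigraph V E) (δ : G.Dart) : V := G.src (G.rev δ)

/-- The degree of a vertex: the number of oriented edges issuing from it (a loop counts twice). -/
def degree [Fintype E] [DecidableEq V] (G : Multigraph V E) (v : V) : ℕ :=
  (Finset.univ.filter fun δ : G.Dart => G.src δ = v).card

/-- The underlying simple graph: distinct vertices are adjacent if some edge joins them. -/
def toSimpleGraph (G : Multigraph V E) : SimpleGraph V :=
  SimpleGraph.fromRel fun i j => ∃ e, G.ends e = (i, j)

/-- Connectedness (a connected graph has at least one vertex). -/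
def Connected (G : Multigraph V E) : Prop := G.toSimpleGraph.Connected

/-! ### The Jacobi matrix of the finite graph -/

/-- The Jacobi matrix `J` with parameters `a` (on edges) and `b` (on vertices), i.e.
`(J u)_i = b_i u_i + ∑ a_α u_j`, the sum being over all oriented edges `α` from `i`, with `j` the
other end of `α`. Multiple edges add up and a loop at `i` adds `2 a_α` to `J i i`. -/
def jacobiMatrix [Fintype E] [DecidableEq V] (G : Multigraph V E) (a : E → ℝ) (b : V → ℝ) :
    Matrix V V ℝ :=
  Matrix.of fun i j => (if i = j then b i else 0) +
    ∑ δ : G.Dart, if G.src δ = i ∧ G.tgt δ = j then a δ.1 else 0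

/-- `σ(a,b)`: the largest eigenvalue of `J`. -/
noncomputable def topEigenvalue [Fintype V] [Fintype E] [DecidableEq V] (G : Multigraph V E)
    (a : E → ℝ) (b : V → ℝ) : ℝ :=
  sSup {μ : ℝ | Module.End.HasEigenvalue (Matrix.toLin' (G.jacobiMatrix a b)) μ}

/-! ### The universal cover

The vertices of the universal cover based at `o` are the walks from `o` without backtracking.
A walk is a list of oriented edges, the last oriented edge being the head of the list. -/

/-- The final vertex of a walk from `o`. -/
def endpoint (G : Multigraph V E) (o : V) : List G.Dart → V
  | [] => o
  | δ :: _ => G.tgt δ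

/-- The list `l`, read from its end, is a walk from `o` that never traverses an edge and then
immediately the same edge in the opposite direction. -/
def IsReduced (G : Multigraph V E) (o : V) : List G.Dart → Prop
  | [] => True
  | δ :: l => G.src δ = G.endpoint o l ∧ l.head? ≠ some (G.rev δ) ∧ IsReduced G o l

/-- The vertices of the universal cover of `G` (base point `o`). -/
@[ext]
structure Cover (G : Multigraph V E) (o : V) where
  walk : List G.Dart
  isReduced : G.IsReduced o walk

variable {G : Multigraph V E} {o : V}

/-- The covering map on vertices. -/
def Cover.proj (w : G.Cover o) : V := G.endpoint o w.walk

@[simp] theorem rev_rev (δ : G.Dart) : G.rev (G.rev δ) = δ := by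
  obtain ⟨e, s⟩ := δ
  simp [rev]

theorem rev_ne (δ : G.Dart) : G.rev δ ≠ δ := by
  obtain ⟨e, s⟩ := δ
  simp [rev]

theorem src_rev (δ : G.Dart) : G.src (G.rev δ) = G.tgt δ := rfl

theorem tgt_rev (δ : G.Dart) : G.tgt (G.rev δ) = G.src δ := by
  simp [tgt]

/-- Follow `δ` after the walk `l` and cancel a backtracking. -/
def stepList [DecidableEq E] (G : Multigraph V E) (δ : G.Dart) : List G.Dart → List G.Dart
  | [] => [δ]
  | ε :: l => if ε = G.rev δ then l else δ :: ε :: l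

theorem isReduced_stepList [DecidableEq E] (δ : G.Dart) (l : List G.Dart)
    (hl : G.IsReduced o l) (hδ : G.src δ = G.endpoint o l) :
    G.IsReduced o (G.stepList δ l) := by
  cases l with
  | nil => exact ⟨hδ, by simp, trivial⟩
  | cons ε l =>
    by_cases h : ε = G.rev δ
    · simpa [stepList, h] using hl.2.2
    · simp only [stepList, if_neg h]
      exact ⟨hδ, by simpa using h, hl⟩

/-- The neighbour of `w` in the universal cover along the lift of the oriented edge `δ` that
starts at `w`. It is meaningful when `δ` issues from `w.proj`; otherwise the value is `w`. As `δ`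
runs over the oriented edges issuing from `w.proj`, the lifts run over the edges of the universal
cover at `w`: the one to the predecessor of `w` if `w` is not the empty walk, and those to the
walks that extend `w` by one edge. -/
def Cover.step [DecidableEq V] [DecidableEq E] (w : G.Cover o) (δ : G.Dart) : G.Cover o :=
  if h : G.src δ = w.proj then ⟨G.stepList δ w.walk, isReduced_stepList δ w.walk w.isReduced h⟩ else w

theorem Cover.walk_step [DecidableEq V] [DecidableEq E] (w : G.Cover o) (δ : G.Dart)
    (h : G.src δ = w.proj) : (w.step δ).walk = G.stepList δ w.walk := by
  simp [Cover.step, h]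

theorem Cover.proj_step [DecidableEq V] [DecidableEq E] (w : G.Cover o) (δ : G.Dart)
    (h : G.src δ = w.proj) : (w.step δ).proj = G.tgt δ := by
  rw [Cover.proj, Cover.walk_step w δ h]
  obtain ⟨l, hl⟩ := w
  cases l with
  | nil => rfl
  | cons ε l =>
    by_cases h' : ε = G.rev δ
    · subst h'
      simpa [stepList, ← src_rev] using hl.1.symm
    · simp [stepList, h', endpoint]

/-- Going along an oriented edge and back returns to the start. -/
theorem Cover.step_step_rev [DecidableEq V] [DecidableEq E] (w : G.Cover o) (δ : G.Dart)
    (h : G.src δ = w.proj) : (w.step δ).step (G.rev δ) = w := by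
  have h2 : G.src (G.rev δ) = (w.step δ).proj := by
    rw [Cover.proj_step w δ h, src_rev]
  apply Cover.ext
  rw [Cover.walk_step _ _ h2, Cover.walk_step w δ h]
  obtain ⟨l, hl⟩ := w
  cases l with
  | nil => simp [stepList]
  | cons ε l =>
    by_cases h' : ε = G.rev δ
    · subst h'
      cases l with
      | nil => simp [stepList]
      | cons η l =>
        have h4 : η ≠ δ := by simpa using hl.2.1
        simp [stepList, h4]
    · simp [stepList, h']

end Multigraph

/-! ### Bounded operators on `ℓ²` -/

theorem weightedComp_sum_le {W : Type*} (c : W → ℂ) (g : W → W) (C : ℝ) (hc : ∀ w, ‖c w‖ ≤ C)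
    (hg : Set.InjOn g {w | c w ≠ 0}) (u : lp (fun _ : W => ℂ) 2) (s : Finset W) :
    ∑ w ∈ s, ‖c w * u (g w)‖ ^ (2 : ENNReal).toReal
      ≤ (|C| * ‖u‖) ^ (2 : ENNReal).toReal := by
  classical
  have h1 : ∑ w ∈ s, ‖c w * u (g w)‖ ^ (2 : ENNReal).toReal
      = ∑ w ∈ s.filter (fun w => c w ≠ 0), ‖c w * u (g w)‖ ^ (2 : ENNReal).toReal := by
    rw [Finset.sum_filter]
    refine Finset.sum_congr rfl fun w _ => ?_
    by_cases h : c w = 0 <;> simp [h]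
  have h2 : ∑ w ∈ s.filter (fun w => c w ≠ 0), ‖u (g w)‖ ^ (2 : ENNReal).toReal
      = ∑ w ∈ (s.filter (fun w => c w ≠ 0)).image g, ‖u w‖ ^ (2 : ENNReal).toReal := by
    rw [Finset.sum_image]
    intro x hx y hy hxy
    exact hg (by simpa using (Finset.mem_filter.1 hx).2)
      (by simpa using (Finset.mem_filter.1 hy).2) hxy
  have h3 := lp.sum_rpow_le_norm_rpow (p := 2) (by norm_num) u
    ((s.filter (fun w => c w ≠ 0)).image g)
  rw [h1, Real.mul_rpow (abs_nonneg _) (norm_nonneg _)]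
  refine le_trans ?_ (mul_le_mul_of_nonneg_left (h2.le.trans h3) (by positivity))
  rw [Finset.mul_sum]
  refine Finset.sum_le_sum fun w _ => ?_
  rw [norm_mul, Real.mul_rpow (norm_nonneg _) (norm_nonneg _)]
  refine mul_le_mul_of_nonneg_right ?_ (by positivity)
  exact Real.rpow_le_rpow (norm_nonneg _) ((hc w).trans (le_abs_self C)) (by norm_num)

/-- The bounded operator `(T u)(w) = c(w) u(g(w))` on `ℓ²(W)`, for a bounded weight `c` and a map
`g` that is injective where `c ≠ 0`. -/
noncomputable def weightedComp {W : Type*} (c : W → ℂ) (g : W → W) (C : ℝ)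
    (hc : ∀ w, ‖c w‖ ≤ C) (hg : Set.InjOn g {w | c w ≠ 0}) :
    lp (fun _ : W => ℂ) 2 →L[ℂ] lp (fun _ : W => ℂ) 2 :=
  LinearMap.mkContinuous
    { toFun := fun u => ⟨fun w => c w * u (g w),
        memℓp_gen' (weightedComp_sum_le c g C hc hg u)⟩
      map_add' := fun u v => by
        ext w
        exact mul_add _ _ _
      map_smul' := fun r u => by
        ext w
        exact mul_left_comm _ _ _ }
    |C| fun u => lp.norm_le_of_forall_sum_le (by norm_num)
      (mul_nonneg (abs_nonneg _) (norm_nonneg _)) (weightedComp_sum_le c g C hc hg u)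

@[simp] theorem weightedComp_apply {W : Type*} (c : W → ℂ) (g : W → W) (C : ℝ)
    (hc : ∀ w, ‖c w‖ ≤ C) (hg : Set.InjOn g {w | c w ≠ 0}) (u : lp (fun _ : W => ℂ) 2) (w : W) :
    weightedComp c g C hc hg u w = c w * u (g w) := rfl

namespace Multigraph

variable {V E : Type*}

/-! ### The periodic Jacobi matrix on the universal cover -/

/-- The contribution to `H` of the lifts of the oriented edge `δ`:
`u ↦ (w ↦ a_δ u(w.step δ))` at the vertices `w` above the initial vertex of `δ`, and `0` at the
other vertices. -/
noncomputable def hop [DecidableEq V] [DecidableEq E] (G : Multigraph V E) (a : E → ℝ) (o : V)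
    (δ : G.Dart) : lp (fun _ : G.Cover o => ℂ) 2 →L[ℂ] lp (fun _ : G.Cover o => ℂ) 2 :=
  weightedComp (fun w => if G.src δ = w.proj then (a δ.1 : ℂ) else 0) (fun w => w.step δ) |a δ.1|
    (fun w => by split_ifs <;> simp)
    (fun x hx y hy hxy => by
      have hx' : G.src δ = x.proj := by
        by_contra h
        simp [h] at hx
      have hy' : G.src δ = y.proj := by
        by_contra h
        simp [h] at hy
      rw [← Cover.step_step_rev x δ hx', ← Cover.step_step_rev y δ hy']
      exact congrArg (fun z => Cover.step z (G.rev δ)) hxy)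

theorem hop_apply [DecidableEq V] [DecidableEq E] (G : Multigraph V E) (a : E → ℝ) (o : V)
    (δ : G.Dart) (u : lp (fun _ : G.Cover o => ℂ) 2) (w : G.Cover o) :
    G.hop a o δ u w = if G.src δ = w.proj then (a δ.1 : ℂ) * u (w.step δ) else 0 := by
  refine (weightedComp_apply _ _ _ _ _ u w).trans ?_
  split_ifs <;> simp

/-- The periodic Jacobi matrix `H` on `ℓ²` of the universal cover: the lift of `J`. -/
noncomputable def jacobiLift [Fintype V] [Fintype E] [DecidableEq V] [DecidableEq E]
    (G : Multigraph V E) (a : E → ℝ) (b : V → ℝ) (o : V) :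
    lp (fun _ : G.Cover o => ℂ) 2 →L[ℂ] lp (fun _ : G.Cover o => ℂ) 2 :=
  weightedComp (fun w => (b w.proj : ℂ)) id (∑ v, |b v|)
    (fun w => by
      simpa using Finset.single_le_sum (f := fun v => |b v|) (fun v _ => abs_nonneg _)
        (Finset.mem_univ w.proj))
    Function.injective_id.injOn
  + ∑ δ : G.Dart, G.hop a o δ

/-- The explicit form of `H`: `(H u)(w) = b(w) u(w) + ∑ a_α u(w')`, over the edges `α` of the
universal cover at `w`, with `w'` the other end. -/
theorem jacobiLift_apply [Fintype V] [Fintype E] [DecidableEq V] [DecidableEq E]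
    (G : Multigraph V E) (a : E → ℝ) (b : V → ℝ) (o : V) (u : lp (fun _ : G.Cover o => ℂ) 2)
    (w : G.Cover o) :
    G.jacobiLift a b o u w = (b w.proj : ℂ) * u w +
      ∑ δ : G.Dart, if G.src δ = w.proj then (a δ.1 : ℂ) * u (w.step δ) else 0 := by
  simp only [jacobiLift, add_apply, sum_apply, lp.coeFn_add, lp.coeFn_sum, Pi.add_apply,
    Finset.sum_apply, hop_apply, weightedComp_apply, id]

/-- `Σ(a,b)`: the supremum of the spectrum of the (bounded, self-adjoint) operator `H`. -/
noncomputable def topSpectrum [Fintype V] [Fintype E] [DecidableEq V] [DecidableEq E]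
    (G : Multigraph V E) (a : E → ℝ) (b : V → ℝ) (o : V) : ℝ :=
  sSup {x : ℝ | (x : ℂ) ∈ spectrum ℂ (G.jacobiLift a b o)}

/-- The gap `G(a,b) = σ(a,b) - Σ(a,b)`. -/
noncomputable def gap [Fintype V] [Fintype E] [DecidableEq V] [DecidableEq E]
    (G : Multigraph V E) (a : E → ℝ) (b : V → ℝ) (o : V) : ℝ :=
  G.topEigenvalue a b - G.topSpectrum a b o

/-! ### The constants of the comparison -/

/-- `S`, the supremum over the edges `α = (i,j)` of `a_α ψ_i ψ_j`. -/
noncomputable def edgeSup (G : Multigraph V E) (a : E → ℝ) (ψ : V → ℝ) : ℝ :=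
  ⨆ e : E, a e * ψ (G.ends e).1 * ψ (G.ends e).2

/-- `S̃`, the supremum over the edges `α = (i,j)` of `1 / (a_α ψ_i ψ_j)`. -/
noncomputable def edgeSupInv (G : Multigraph V E) (a : E → ℝ) (ψ : V → ℝ) : ℝ :=
  ⨆ e : E, 1 / (a e * ψ (G.ends e).1 * ψ (G.ends e).2)

/-- `I`, the infimum over the vertices of `ψ_i²`. -/
noncomputable def vertexInf (_G : Multigraph V E) (ψ : V → ℝ) : ℝ := ⨅ i : V, ψ i ^ 2

/-- `Ĩ`, the infimum over the vertices of `1 / ψ_i²`. -/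
noncomputable def vertexInfInv (_G : Multigraph V E) (ψ : V → ℝ) : ℝ := ⨅ i : V, 1 / ψ i ^ 2

end Multigraph

/-! The proof rests on the ground state representation. Lift $\psi$ to the cover and write $f=\psi
u$. Then $\langle f,(\sigma-H)f\rangle$ is half the sum, over all oriented edges of the tree, of
$a_\alpha\psi_i\psi_j\,|u(w)-u(w')|^2$, because $J\psi=\sigma\psi$ makes the diagonal terms cancel
(`re_inner_jacobiLift_eq`). By the Rayleigh principle the gap is the infimum of this form divided by
$\sum\psi^2|u|^2$. Bounding the edge and vertex weights by constants leaves the unweighted Dirichlet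
form of the $d$-regular tree, whose infimum on unit vectors is $d-2\sqrt{d-1}$.

Put $q=\sqrt{d-1}$. That the adjacency form is at most $2q\|u\|^2$ is a Schur test with the radial
function $q^{-|w|}$ (`sum_cross_le`). It is sharp because each sphere of radius $k$ has between
$q^{2k}$ and $2q^{2k}$ points: the truncation of $q^{-|w|}$ to a ball of radius $n$ has square norm
at least $n$ but loses only a bounded amount at the root and the boundary (`le_sum_cross_radial`).
The two comparisons are `mul_le_gap` and `mul_gap_le`. -/

section Rayleigh

/-! ### Top of the spectrum through the quadratic form -/

variable {F : Type*} [NormedAddCommGroup F] [InnerProductSpace ℂ F] [CompleteSpace F]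

/-- Both sides say $T\le c$ in the Loewner order: one by functional calculus, the other by
positivity of the form of $c-T$. -/
theorem IsSelfAdjoint.spectrum_real_le_iff {T : F →L[ℂ] F} (hT : IsSelfAdjoint T) (c : ℝ) :
    (∀ x : ℝ, (x : ℂ) ∈ spectrum ℂ T → x ≤ c) ↔
      ∀ f : F, (inner ℂ f (T f)).re ≤ c * ‖f‖ ^ 2 := by
  have h1 : T ≤ algebraMap ℝ (F →L[ℂ] F) c ↔ ∀ x ∈ spectrum ℝ T, x ≤ c :=
    le_algebraMap_iff_spectrum_le hT
  have h2 : ∀ x : ℝ, (x : ℂ) ∈ spectrum ℂ T ↔ x ∈ spectrum ℝ T := fun x =>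
    spectrum.algebraMap_mem_iff ℂ (R := ℝ)
  have hsa : IsSelfAdjoint (algebraMap ℝ (F →L[ℂ] F) c - T) :=
    (IsSelfAdjoint.algebraMap _ (IsSelfAdjoint.all c)).sub hT
  have h3 : ∀ f : F, (algebraMap ℝ (F →L[ℂ] F) c - T).reApplyInnerSelf f =
      c * ‖f‖ ^ 2 - (inner ℂ f (T f)).re := fun f => by
    have h4 : (algebraMap ℝ (F →L[ℂ] F) c) f = (c : ℂ) • f := by
      simp [Algebra.algebraMap_eq_smul_one]
    rw [ContinuousLinearMap.reApplyInnerSelf_apply, sub_apply, h4,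
      inner_sub_left, map_sub, inner_smul_left, ← inner_re_symm f]
    simp [inner_self_eq_norm_sq_to_K, ← Complex.ofReal_pow]
  simp only [h2]
  rw [← h1, ContinuousLinearMap.le_def, ContinuousLinearMap.isPositive_def']
  simp only [h3, sub_nonneg, hsa, true_and]

/-- Rules out the default value of the real `sSup`: the spectrum is bounded by $\|T\|$, and nonempty
because the space is nontrivial. -/
theorem IsSelfAdjoint.isLUB_sSup_spectrum_real [Nontrivial F] {T : F →L[ℂ] F}
    (hT : IsSelfAdjoint T) :
    IsLUB {x : ℝ | (x : ℂ) ∈ spectrum ℂ T} (sSup {x : ℝ | (x : ℂ) ∈ spectrum ℂ T}) := by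
  apply isLUB_csSup
  · obtain ⟨x, hx⟩ := ContinuousFunctionalCalculus.spectrum_nonempty (R := ℝ) T hT
    exact ⟨x, (spectrum.algebraMap_mem_iff ℂ (R := ℝ)).2 hx⟩
  · refine ⟨‖T‖, fun x hx => ?_⟩
    have := spectrum.norm_le_norm_of_mem hx
    exact (le_abs_self x).trans this

theorem IsSelfAdjoint.re_inner_le_sSup_spectrum [Nontrivial F] {T : F →L[ℂ] F}
    (hT : IsSelfAdjoint T) (f : F) :
    (inner ℂ f (T f)).re ≤ sSup {x : ℝ | (x : ℂ) ∈ spectrum ℂ T} * ‖f‖ ^ 2 :=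
  (hT.spectrum_real_le_iff _).1 (fun _ hx => hT.isLUB_sSup_spectrum_real.1 hx) f

theorem IsSelfAdjoint.sSup_spectrum_le [Nontrivial F] {T : F →L[ℂ] F}
    (hT : IsSelfAdjoint T) {c : ℝ} (h : ∀ f : F, (inner ℂ f (T f)).re ≤ c * ‖f‖ ^ 2) :
    sSup {x : ℝ | (x : ℂ) ∈ spectrum ℂ T} ≤ c :=
  hT.isLUB_sSup_spectrum_real.2 fun x hx => (hT.spectrum_real_le_iff c).2 h x hx

end Rayleigh

/-! ### Edge weights and radial functions -/

namespace Multigraph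

variable {V E : Type*} {G : Multigraph V E} {o : V}

/-- Orientation reversal as a permutation of the oriented edges. -/
def revEquiv (G : Multigraph V E) : G.Dart ≃ G.Dart where
  toFun := G.rev
  invFun := G.rev
  left_inv := rev_rev
  right_inv := rev_rev

theorem abs_re_inner_le (x y : ℂ) : |(inner ℂ x y).re| ≤ ‖x‖ ^ 2 + ‖y‖ ^ 2 := by
  have h := (Complex.abs_re_le_norm (inner ℂ x y)).trans (norm_inner_le_norm x y)
  nlinarith [sq_nonneg (‖x‖ - ‖y‖), sq_nonneg ‖x‖, sq_nonneg ‖y‖]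

theorem re_inner_mul_mul (r s : ℝ) (x y : ℂ) :
    (inner ℂ ((r : ℂ) * x) ((s : ℂ) * y)).re = r * s * (inner ℂ x y).re := by
  rw [← smul_eq_mul, ← smul_eq_mul, inner_smul_left, inner_smul_right, Complex.conj_ofReal,
    Complex.re_ofReal_mul, Complex.re_ofReal_mul, mul_assoc]

theorem summable_norm_sq (f : lp (fun _ : G.Cover o => ℂ) 2) : Summable fun w => ‖f w‖ ^ 2 := by
  simpa using (lp.memℓp f).summable (by norm_num)

theorem norm_sq_eq_tsum (f : lp (fun _ : G.Cover o => ℂ) 2) :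
    ‖f‖ ^ 2 = ∑' w, ‖f w‖ ^ 2 := by
  simpa using lp.norm_rpow_eq_tsum (p := 2) (by norm_num) f

/-- The weight `a_α ψ_i ψ_j` of the edge `α = (i, j)`. -/
def edgeWeight (G : Multigraph V E) (a : E → ℝ) (ψ : V → ℝ) (e : E) : ℝ :=
  a e * ψ (G.ends e).1 * ψ (G.ends e).2

/-- The weight is symmetric in the two ends, so either orientation computes it. -/
theorem edgeWeight_dart (a : E → ℝ) (ψ : V → ℝ) (δ : G.Dart) :
    G.edgeWeight a ψ δ.1 = a δ.1 * (ψ (G.src δ) * ψ (G.tgt δ)) := by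
  obtain ⟨e, s⟩ := δ
  cases s <;> simp [edgeWeight, tgt, src, rev] <;> ring

/-- The radial function `q ^ (-|w|)`, cut off outside the ball of radius `n`. -/
noncomputable def radial (G : Multigraph V E) (o : V) (q : ℝ) (n : ℕ) (w : G.Cover o) : ℝ :=
  if w.walk.length ≤ n then q⁻¹ ^ w.walk.length else 0

theorem radial_nonneg {q : ℝ} (hq : 0 ≤ q) (n : ℕ) (w : G.Cover o) : 0 ≤ radial G o q n w := by
  unfold radial
  split_ifs <;> positivity

theorem Cover.src_eq_proj_of_head (w : G.Cover o) (δ : G.Dart)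
    (h' : w.walk.head? = some (G.rev δ)) : G.src δ = w.proj := by
  obtain ⟨l, hl⟩ := w
  cases l with
  | nil => simp at h'
  | cons ε l =>
    have : ε = G.rev δ := by simpa using h'
    simp [Cover.proj, endpoint, this, tgt_rev]

/-! ### Spheres and balls around the root -/

section Sphere

variable [Fintype E]

theorem sum_rev {M : Type*} [AddCommMonoid M] (g : G.Dart → M) :
    ∑ δ, g (G.rev δ) = ∑ δ, g δ :=
  G.revEquiv.sum_comp g

theorem finite_sphere (G : Multigraph V E) (o : V) (n : ℕ) :
    {w : G.Cover o | w.walk.length = n}.Finite :=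
  (List.finite_length_eq G.Dart n).preimage fun _ _ _ _ h => Cover.ext h

/-- The vertices of the universal cover at distance `n` from the root. -/
noncomputable def sphere (G : Multigraph V E) (o : V) (n : ℕ) : Finset (G.Cover o) :=
  (finite_sphere G o n).toFinset

theorem mem_sphere {n : ℕ} {w : G.Cover o} : w ∈ G.sphere o n ↔ w.walk.length = n := by
  simp [sphere]

theorem pairwiseDisjoint_sphere (G : Multigraph V E) (o : V) (s : Set ℕ) :
    s.PairwiseDisjoint (G.sphere o) := fun _ _ _ _ hij =>
  Finset.disjoint_left.2 fun _ hi hj => hij ((mem_sphere.1 hi).symm.trans (mem_sphere.1 hj))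

/-- The ball of radius `n` around the root. -/
noncomputable def ball (G : Multigraph V E) (o : V) (n : ℕ) : Finset (G.Cover o) :=
  (Finset.range (n + 1)).disjiUnion (G.sphere o) (pairwiseDisjoint_sphere G o _)

theorem mem_ball {n : ℕ} {w : G.Cover o} : w ∈ G.ball o n ↔ w.walk.length ≤ n := by
  simp [ball, mem_sphere]

theorem radial_of_notMem_ball {q : ℝ} {n : ℕ} {w : G.Cover o} (h : w ∉ G.ball o n) :
    radial G o q n w = 0 :=
  if_neg (mt mem_ball.2 h)

theorem sum_sphere_radial_sq {q : ℝ} {n k : ℕ} (hk : k ≤ n) :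
    ∑ w ∈ G.sphere o k, radial G o q n w ^ 2 = (G.sphere o k).card * ((q ^ 2) ^ k)⁻¹ := by
  rw [← nsmul_eq_mul, ← Finset.sum_const]
  refine Finset.sum_congr rfl fun w hw => ?_
  rw [radial, mem_sphere.1 hw, if_pos hk, ← pow_mul, ← pow_mul, inv_pow, mul_comm]

theorem card_sphere_zero : (G.sphere o 0).card = 1 := by
  rw [Finset.card_eq_one]
  refine ⟨⟨[], trivial⟩, ?_⟩
  ext w
  simp [mem_sphere, Cover.ext_iff]

end Sphere

/-! ### Weights for the Schur test -/

section StepWeight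

variable [DecidableEq E]

/-- The weight `q` for the step towards the root and `q⁻¹` for the steps away from it. -/
noncomputable def Cover.stepWeight (q : ℝ) (w : G.Cover o) (δ : G.Dart) : ℝ :=
  if w.walk.head? = some (G.rev δ) then q else q⁻¹

theorem Cover.stepWeight_pos {q : ℝ} (hq : 0 < q) (w : G.Cover o) (δ : G.Dart) :
    0 < w.stepWeight q δ := by
  unfold Cover.stepWeight
  split_ifs <;> positivity

theorem Cover.stepWeight_le {q : ℝ} (hq : 1 ≤ q) (w : G.Cover o) (δ : G.Dart) :
    w.stepWeight q δ ≤ q := by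
  unfold Cover.stepWeight
  split_ifs
  · exact le_rfl
  · exact (inv_le_one_of_one_le₀ hq).trans hq

end StepWeight

/-! ### Sums over the fibres of the covering map -/

variable [DecidableEq V]

/-- Bridge from the `if` sums, decided by `DecidableEq V`, to the indicators used in summability and
subtype lemmas. -/
theorem indicator_src {M : Type*} [AddCommMonoid M] (f : G.Cover o → M) (δ : G.Dart) :
    Set.indicator {w : G.Cover o | G.src δ = w.proj} f =
      fun w => if G.src δ = w.proj then f w else 0 := by
  classical
  funext w
  rw [Set.indicator_apply]
  exact if_congr Iff.rfl rfl rfl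

theorem summable_src {g : G.Cover o → ℝ} (hg : Summable g) (δ : G.Dart) :
    Summable fun w : G.Cover o => if G.src δ = w.proj then g w else 0 := by
  rw [← indicator_src]
  exact hg.indicator _

/-- The sum of `|u|²` over the vertices above the initial vertex of `δ`. -/
noncomputable def mass (u : G.Cover o → ℂ) (δ : G.Dart) : ℝ :=
  ∑' w : G.Cover o, if G.src δ = w.proj then ‖u w‖ ^ 2 else 0

section FintypeEdges

variable [Fintype E]

theorem sum_mul_mass {u : G.Cover o → ℂ} (hu : Summable fun w => ‖u w‖ ^ 2) (m : E → ℝ) :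
    ∑ δ : G.Dart, m δ.1 * mass u δ =
      ∑' w : G.Cover o, (∑ δ : G.Dart, if G.src δ = w.proj then m δ.1 else 0) * ‖u w‖ ^ 2 := by
  simp only [mass, ← tsum_mul_left]
  rw [← Summable.tsum_finsetSum fun δ _ => (summable_src hu δ).mul_left _]
  refine tsum_congr fun w => ?_
  rw [Finset.sum_mul]
  refine Finset.sum_congr rfl fun δ _ => ?_
  split_ifs <;> simp

/-- This is the eigenvalue equation at `v` multiplied by `ψ v`. -/
theorem sum_edgeWeight [Fintype V] {a : E → ℝ} {b ψ : V → ℝ} {σ : ℝ}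
    (h : G.jacobiMatrix a b *ᵥ ψ = σ • ψ) (v : V) :
    (∑ δ : G.Dart, if G.src δ = v then G.edgeWeight a ψ δ.1 else 0) = (σ - b v) * ψ v ^ 2 := by
  have h1 : b v * ψ v + ∑ δ : G.Dart, (if G.src δ = v then a δ.1 * ψ (G.tgt δ) else 0) =
      σ * ψ v := by
    have := congrFun h v
    simp only [Matrix.mulVec, dotProduct, jacobiMatrix, Matrix.of_apply, add_mul, ite_mul,
      zero_mul, Finset.sum_add_distrib, Finset.sum_ite_eq, Finset.mem_univ, if_true,
      Finset.sum_mul, Pi.smul_apply, smul_eq_mul] at this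
    rw [← this, Finset.sum_comm]
    congr 1
    refine Finset.sum_congr rfl fun δ _ => ?_
    by_cases hδ : G.src δ = v <;> simp [hδ]
  have h2 : (∑ δ : G.Dart, if G.src δ = v then G.edgeWeight a ψ δ.1 else 0) =
      ψ v * ∑ δ : G.Dart, (if G.src δ = v then a δ.1 * ψ (G.tgt δ) else 0) := by
    rw [Finset.mul_sum]
    refine Finset.sum_congr rfl fun δ _ => ?_
    split_ifs with hδ
    · rw [edgeWeight_dart, hδ]
      ring
    · simp
  rw [h2]
  linear_combination ψ v * h1

end FintypeEdges

/-! ### Lifted edges as bijections between fibres -/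

variable [DecidableEq E]

theorem Cover.src_rev_step (w : G.Cover o) (δ : G.Dart) (h : G.src δ = w.proj) :
    G.src (G.rev δ) = (w.step δ).proj := by
  rw [Cover.proj_step w δ h, src_rev]

/-- The lift of the oriented edge `δ` matches the vertices above its two ends. -/
def Cover.stepEquiv (G : Multigraph V E) (o : V) (δ : G.Dart) :
    {w : G.Cover o | G.src δ = w.proj} ≃ {w : G.Cover o | G.src (G.rev δ) = w.proj} where
  toFun w := ⟨w.1.step δ, w.1.src_rev_step δ w.2⟩
  invFun w := ⟨w.1.step (G.rev δ), by
    have := w.1.src_rev_step (G.rev δ) w.2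
    rwa [rev_rev] at this⟩
  left_inv w := Subtype.ext (w.1.step_step_rev δ w.2)
  right_inv w := Subtype.ext (by
    have := w.1.step_step_rev (G.rev δ) w.2
    rwa [rev_rev] at this)

/-- Summing over the lifts of an oriented edge, one may start from either end. -/
theorem tsum_step_swap {M : Type*} [AddCommMonoid M] [TopologicalSpace M]
    (f : G.Cover o → G.Cover o → M) (δ : G.Dart) :
    (∑' w : G.Cover o, if G.src δ = w.proj then f w (w.step δ) else 0) =
      ∑' w : G.Cover o, if G.src (G.rev δ) = w.proj then f (w.step (G.rev δ)) w else 0 := by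
  have h1 := tsum_subtype {w : G.Cover o | G.src δ = w.proj} fun w => f w (w.step δ)
  have h2 := tsum_subtype {w : G.Cover o | G.src (G.rev δ) = w.proj}
    fun w => f (w.step (G.rev δ)) w
  rw [indicator_src] at h1 h2
  rw [← h1, ← h2, ← (Cover.stepEquiv G o δ).tsum_eq]
  refine tsum_congr fun w => ?_
  simp only [Cover.stepEquiv, Equiv.coe_fn_mk]
  rw [w.1.step_step_rev δ w.2]

theorem summable_step {g : G.Cover o → ℝ} (hg : Summable g) (δ : G.Dart) :
    Summable fun w : G.Cover o => if G.src δ = w.proj then g (w.step δ) else 0 := by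
  rw [← indicator_src (fun w => g (w.step δ)), ← summable_subtype_iff_indicator]
  exact (Cover.stepEquiv G o δ).summable_iff.2 (hg.subtype _)

/-! ### Quadratic forms on the universal cover -/

variable {u : G.Cover o → ℂ}

/-- Lifts of `δ` read backwards are lifts of `G.rev δ` with the same real coefficient, so the two
hops are mutually adjoint. -/
theorem inner_hop_left (a : E → ℝ) (δ : G.Dart) (f g : lp (fun _ : G.Cover o => ℂ) 2) :
    inner ℂ (G.hop a o δ f) g = inner ℂ f (G.hop a o (G.rev δ) g) := by
  rw [lp.inner_eq_tsum, lp.inner_eq_tsum]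
  refine Eq.trans (tsum_congr fun w => ?_)
    ((tsum_step_swap (fun w w' => inner ℂ ((a δ.1 : ℂ) * f w') (g w)) δ).trans
      (tsum_congr fun w => ?_))
  · rw [hop_apply]
    split_ifs <;> simp
  · rw [hop_apply]
    split_ifs
    · simp only [RCLike.inner_apply, map_mul, Complex.conj_ofReal, rev]
      ring
    · simp

/-- The sum of `Re (ū(w) u(w'))` over the lifts `(w, w')` of the oriented edge `δ`. -/
noncomputable def cross (u : G.Cover o → ℂ) (δ : G.Dart) : ℝ :=
  ∑' w : G.Cover o, if G.src δ = w.proj then (inner ℂ (u w) (u (w.step δ))).re else 0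

/-- The sum of `|u(w) - u(w')|²` over the lifts `(w, w')` of the oriented edge `δ`. -/
noncomputable def dirichlet (u : G.Cover o → ℂ) (δ : G.Dart) : ℝ :=
  ∑' w : G.Cover o, if G.src δ = w.proj then ‖u w - u (w.step δ)‖ ^ 2 else 0

theorem dirichlet_nonneg (u : G.Cover o → ℂ) (δ : G.Dart) : 0 ≤ dirichlet u δ :=
  tsum_nonneg fun w => by split_ifs <;> positivity

theorem mass_rev (u : G.Cover o → ℂ) (δ : G.Dart) :
    mass u (G.rev δ) = ∑' w : G.Cover o, if G.src δ = w.proj then ‖u (w.step δ)‖ ^ 2 else 0 := by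
  have h := tsum_step_swap (fun _ w' => ‖u w'‖ ^ 2) δ
  exact h.symm

theorem summable_cross (hu : Summable fun w => ‖u w‖ ^ 2) (δ : G.Dart) :
    Summable fun w : G.Cover o =>
      if G.src δ = w.proj then (inner ℂ (u w) (u (w.step δ))).re else 0 := by
  refine Summable.of_norm_bounded ((summable_src hu δ).add (summable_step hu δ)) fun w => ?_
  split_ifs
  · exact abs_re_inner_le _ _
  · simp

theorem dirichlet_eq (hu : Summable fun w => ‖u w‖ ^ 2) (δ : G.Dart) :
    dirichlet u δ = mass u δ + mass u (G.rev δ) - 2 * cross u δ := by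
  rw [mass_rev, mass, cross, dirichlet, ← tsum_mul_left,
    ← (summable_src hu δ).tsum_add (summable_step hu δ),
    ← ((summable_src hu δ).add (summable_step hu δ)).tsum_sub ((summable_cross hu δ).mul_left 2)]
  refine tsum_congr fun w => ?_
  split_ifs
  · rw [norm_sub_sq (𝕜 := ℂ), RCLike.re_eq_complex_re]
    ring
  · simp

/-- Along every lift of `δ` the factors $\psi$ at the two ends are the same constants, so they can
be absorbed into the edge coefficient. -/
theorem mul_cross_eq (a : E → ℝ) (ψ : V → ℝ) {f u : G.Cover o → ℂ}
    (hfu : ∀ w, f w = (ψ w.proj : ℂ) * u w) (δ : G.Dart) :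
    a δ.1 * cross f δ = G.edgeWeight a ψ δ.1 * cross u δ := by
  rw [cross, cross, ← tsum_mul_left, ← tsum_mul_left]
  refine tsum_congr fun w => ?_
  split_ifs with hδ
  · rw [edgeWeight_dart, hfu, hfu, Cover.proj_step w δ hδ, ← hδ, re_inner_mul_mul]
    ring
  · simp

/-! ### Geometry of the universal cover -/

/-- A step either appends `δ` or cancels the last edge; after a cancellation, reducedness forbids
the remaining walk from ending in `δ`. -/
theorem Cover.head_step_iff (w : G.Cover o) (δ : G.Dart) (h : G.src δ = w.proj) :
    (w.step δ).walk.head? = some δ ↔ w.walk.head? ≠ some (G.rev δ) := by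
  rw [Cover.walk_step w δ h]
  obtain ⟨l, hl⟩ := w
  cases l with
  | nil => simp [stepList]
  | cons ε l =>
    by_cases h' : ε = G.rev δ
    · subst h'
      simpa [stepList] using hl.2.1
    · simp [stepList, h']

theorem Cover.walk_step_of_head_ne (w : G.Cover o) (δ : G.Dart) (h : G.src δ = w.proj)
    (h' : w.walk.head? ≠ some (G.rev δ)) : (w.step δ).walk = δ :: w.walk := by
  rw [Cover.walk_step w δ h]
  obtain ⟨l, hl⟩ := w
  cases l with
  | nil => simp [stepList]
  | cons ε l =>
    have : ε ≠ G.rev δ := by simpa using h'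
    simp [stepList, this]

theorem Cover.walk_eq_cons_step (w : G.Cover o) (δ : G.Dart) (h : G.src δ = w.proj)
    (h' : w.walk.head? = some (G.rev δ)) : w.walk = G.rev δ :: (w.step δ).walk := by
  rw [Cover.walk_step w δ h]
  obtain ⟨l, hl⟩ := w
  cases l with
  | nil => simp at h'
  | cons ε l =>
    have : ε = G.rev δ := by simpa using h'
    simp [stepList, this]

/-- An edge leading towards the root from one end leads away from it at the other. -/
theorem Cover.stepWeight_mul_rev {q : ℝ} (hq : q ≠ 0) (w : G.Cover o) (δ : G.Dart)
    (h : G.src δ = w.proj) : w.stepWeight q δ * (w.step δ).stepWeight q (G.rev δ) = 1 := by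
  unfold Cover.stepWeight
  rw [rev_rev]
  by_cases h' : w.walk.head? = some (G.rev δ)
  · have := (not_congr (w.head_step_iff δ h)).2 (not_not.2 h')
    rw [if_pos h', if_neg this, mul_inv_cancel₀ hq]
  · rw [if_neg h', if_pos ((w.head_step_iff δ h).2 h'), inv_mul_cancel₀ hq]

/-- Step weights are the ratios of neighbouring values of $q^{-|w|}$. Strictness of `hn` keeps an
outward step inside the cut-off. -/
theorem radial_step {q : ℝ} (hq : q ≠ 0) {n : ℕ} (w : G.Cover o) (δ : G.Dart)
    (h : G.src δ = w.proj) (hn : w.walk.length < n) :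
    radial G o q n (w.step δ) = w.stepWeight q δ * radial G o q n w := by
  unfold radial Cover.stepWeight
  by_cases h' : w.walk.head? = some (G.rev δ)
  · have h1 : w.walk.length = (w.step δ).walk.length + 1 := by
      conv_lhs => rw [w.walk_eq_cons_step δ h h', List.length_cons]
    rw [if_pos h', if_pos (by lia), if_pos (by lia), h1, pow_succ]
    field_simp
  · have h1 := congrArg List.length (w.walk_step_of_head_ne δ h h')
    rw [List.length_cons] at h1
    rw [if_neg h', if_pos (by lia), if_pos (by lia), h1, pow_succ, mul_comm]

variable [Fintype E]

/-- Polarization on each edge. Since `m` ignores orientation, the masses at the two ends have equal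
sums over all oriented edges. -/
theorem sum_mul_cross (hu : Summable fun w => ‖u w‖ ^ 2) (m : E → ℝ) :
    ∑ δ : G.Dart, m δ.1 * cross u δ =
      (∑' w : G.Cover o, (∑ δ : G.Dart, if G.src δ = w.proj then m δ.1 else 0) * ‖u w‖ ^ 2) -
        (∑ δ : G.Dart, m δ.1 * dirichlet u δ) / 2 := by
  have h := sum_rev fun δ : G.Dart => m δ.1 * mass u δ
  have h2 : ∑ δ : G.Dart, m δ.1 * dirichlet u δ =
      ∑ δ : G.Dart, m δ.1 * mass u δ + ∑ δ : G.Dart, m (G.rev δ).1 * mass u (G.rev δ)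
        - 2 * ∑ δ : G.Dart, m δ.1 * cross u δ := by
    rw [Finset.mul_sum, ← Finset.sum_add_distrib, ← Finset.sum_sub_distrib]
    refine Finset.sum_congr rfl fun δ _ => ?_
    rw [dirichlet_eq hu]
    simp only [rev]
    ring
  rw [← sum_mul_mass hu, h2, h]
  ring

/-- The oriented edges along which a vertex of the universal cover is left away from the root. -/
def Cover.ahead (w : G.Cover o) : Finset G.Dart :=
  Finset.univ.filter fun δ => G.src δ = w.proj ∧ w.walk.head? ≠ some (G.rev δ)

theorem Cover.mem_ahead (w : G.Cover o) (δ : G.Dart) :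
    δ ∈ w.ahead ↔ G.src δ = w.proj ∧ w.walk.head? ≠ some (G.rev δ) := by
  simp [Cover.ahead]

theorem Cover.filter_src_eq_ahead (w : G.Cover o) (h : w.walk = []) :
    (Finset.univ.filter fun δ : G.Dart => G.src δ = w.proj) = w.ahead := by
  ext δ
  simp [Cover.ahead, h]

/-- Away from the root exactly one edge leads back. The `cons` form splits both cardinalities and
sums. -/
theorem Cover.exists_filter_src_eq_cons (w : G.Cover o) (h : w.walk ≠ []) :
    ∃ η, w.walk.head? = some (G.rev η) ∧ ∃ hη : η ∉ w.ahead,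
      (Finset.univ.filter fun δ : G.Dart => G.src δ = w.proj) = w.ahead.cons η hη := by
  obtain ⟨ε, l, hl⟩ := List.exists_cons_of_ne_nil h
  have h1 : w.walk.head? = some (G.rev (G.rev ε)) := by simp [hl]
  refine ⟨G.rev ε, h1, by simp [Cover.mem_ahead, h1], ?_⟩
  ext δ
  rw [Finset.mem_cons, Cover.mem_ahead, Finset.mem_filter]
  simp only [Finset.mem_univ, true_and]
  by_cases hδ : w.walk.head? = some (G.rev δ)
  · have h2 : δ = G.rev ε := by
      rw [h1] at hδ
      have := congrArg G.rev (Option.some.inj hδ)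
      rwa [rev_rev, rev_rev, eq_comm] at this
    simp [h2, w.src_eq_proj_of_head _ h1]
  · have h2 : δ ≠ G.rev ε := by
      rintro rfl
      exact hδ h1
    simp [h2, hδ]

theorem Cover.card_ahead_of_eq_nil {d : ℕ} (hdeg : ∀ v, G.degree v = d) (w : G.Cover o)
    (h : w.walk = []) : w.ahead.card = d := by
  rw [← w.filter_src_eq_ahead h]
  exact hdeg _

theorem Cover.card_ahead_of_ne_nil {d : ℕ} (hdeg : ∀ v, G.degree v = d) (w : G.Cover o)
    (h : w.walk ≠ []) : w.ahead.card + 1 = d := by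
  obtain ⟨η, -, hη, h1⟩ := w.exists_filter_src_eq_cons h
  rw [← Finset.card_cons hη, ← h1]
  exact hdeg _

/-! ### The adjacency operator of the regular tree is bounded by `2 √(d - 1)` -/

theorem Cover.sum_ahead_stepWeight (q : ℝ) (w : G.Cover o) :
    ∑ δ ∈ w.ahead, w.stepWeight q δ = w.ahead.card * q⁻¹ := by
  rw [← nsmul_eq_mul, ← Finset.sum_const]
  refine Finset.sum_congr rfl fun δ hδ => ?_
  rw [Cover.stepWeight, if_neg ((w.mem_ahead δ).1 hδ).2]

/-- One step back and $d-1=q^2$ steps outward give $q+q^2q^{-1}$. -/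
theorem Cover.sum_stepWeight_of_ne_nil {d : ℕ} (hdeg : ∀ v, G.degree v = d) {q : ℝ} (hq : q ≠ 0)
    (hqd : q ^ 2 = d - 1) (w : G.Cover o) (h : w.walk ≠ []) :
    (∑ δ : G.Dart, if G.src δ = w.proj then w.stepWeight q δ else 0) = 2 * q := by
  have hc : (w.ahead.card : ℝ) = q ^ 2 := by
    rw [hqd, ← w.card_ahead_of_ne_nil hdeg h]
    simp
  obtain ⟨η, hη1, hη, h1⟩ := w.exists_filter_src_eq_cons h
  rw [← Finset.sum_filter, h1, Finset.sum_cons, w.sum_ahead_stepWeight, hc, Cover.stepWeight,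
    if_pos hη1]
  field_simp
  ring

theorem Cover.sum_stepWeight_le {d : ℕ} (hd : 2 ≤ d) (hdeg : ∀ v, G.degree v = d) {q : ℝ}
    (hq : 0 < q) (hqd : q ^ 2 = d - 1) (w : G.Cover o) :
    (∑ δ : G.Dart, if G.src δ = w.proj then w.stepWeight q δ else 0) ≤ 2 * q := by
  by_cases h : w.walk = []
  -- At the root all $d$ weights are $q^{-1}$, and $d\le 2q^2=2(d-1)$ because $d\ge2$.
  · rw [← Finset.sum_filter, w.filter_src_eq_ahead h, w.sum_ahead_stepWeight,
      w.card_ahead_of_eq_nil hdeg h, ← div_eq_mul_inv, div_le_iff₀ hq]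
    have : (2 : ℝ) ≤ d := by exact_mod_cast hd
    nlinarith
  · exact (w.sum_stepWeight_of_ne_nil hdeg hq.ne' hqd h).le

/-- The adjacency form of the `d`-regular tree is at most `2 √(d - 1)` times the square norm. -/
theorem sum_cross_le {d : ℕ} (hd : 2 ≤ d) (hdeg : ∀ v, G.degree v = d) {q : ℝ} (hq : 1 ≤ q)
    (hqd : q ^ 2 = d - 1) (hu : Summable fun w => ‖u w‖ ^ 2) :
    ∑ δ : G.Dart, cross u δ ≤ 2 * q * ∑' w, ‖u w‖ ^ 2 := by
  have hq0 : 0 < q := one_pos.trans_le hq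
  -- The near-end term of the Schur test; `P (G.rev δ)` supplies the far-end term with the inverse
  -- weight.
  let P : G.Dart → ℝ := fun δ =>
    ∑' w : G.Cover o, if G.src δ = w.proj then w.stepWeight q δ * ‖u w‖ ^ 2 else 0
  have hP : ∀ δ : G.Dart, Summable fun w : G.Cover o =>
      if G.src δ = w.proj then w.stepWeight q δ * ‖u w‖ ^ 2 else 0 := fun δ => by
    refine Summable.of_norm_bounded (hu.mul_left q) fun w => ?_
    have h1 := w.stepWeight_le hq δ
    have h2 := (w.stepWeight_pos hq0 δ).le
    split_ifs
    · rw [Real.norm_of_nonneg (by positivity)]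
      gcongr
    · rw [norm_zero]
      positivity
  have hstep : ∀ δ : G.Dart, Summable fun w : G.Cover o => if G.src δ = w.proj then
      (w.step δ).stepWeight q (G.rev δ) * ‖u (w.step δ)‖ ^ 2 else 0 := fun δ => by
    refine Summable.of_norm_bounded ((summable_step hu δ).mul_left q) fun w => ?_
    have h1 := (w.step δ).stepWeight_le hq (G.rev δ)
    have h2 := ((w.step δ).stepWeight_pos hq0 (G.rev δ)).le
    split_ifs
    · rw [Real.norm_of_nonneg (by positivity)]
      gcongr
    · simp
  have hrev : ∀ δ : G.Dart, P (G.rev δ) = ∑' w : G.Cover o, if G.src δ = w.proj then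
      (w.step δ).stepWeight q (G.rev δ) * ‖u (w.step δ)‖ ^ 2 else 0 := fun δ =>
    (tsum_step_swap (fun _ w' => w'.stepWeight q (G.rev δ) * ‖u w'‖ ^ 2) δ).symm
  have hcross : ∀ δ : G.Dart, 2 * cross u δ ≤ P δ + P (G.rev δ) := fun δ => by
    rw [hrev, cross, ← tsum_mul_left, ← (hP δ).tsum_add (hstep δ)]
    refine ((summable_cross hu δ).mul_left 2).tsum_le_tsum (fun w => ?_)
      ((hP δ).add (hstep δ))
    split_ifs with h
    · have h1 := w.stepWeight_mul_rev hq0.ne' δ h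
      have h2 := w.stepWeight_pos hq0 δ
      have h3 := (Complex.re_le_norm _).trans (norm_inner_le_norm (𝕜 := ℂ) (u w) (u (w.step δ)))
      have h4 : (w.step δ).stepWeight q (G.rev δ) = (w.stepWeight q δ)⁻¹ :=
        eq_inv_of_mul_eq_one_right h1
      -- Weighted AM-GM, $2xy\le sx^2+s^{-1}y^2$, by completing the square.
      have h5 : w.stepWeight q δ * ‖u w‖ ^ 2 + (w.stepWeight q δ)⁻¹ * ‖u (w.step δ)‖ ^ 2
          - 2 * (‖u w‖ * ‖u (w.step δ)‖) =
          (w.stepWeight q δ)⁻¹ * (w.stepWeight q δ * ‖u w‖ - ‖u (w.step δ)‖) ^ 2 := by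
        field_simp
        ring
      have h6 : 0 ≤ (w.stepWeight q δ)⁻¹ * (w.stepWeight q δ * ‖u w‖ - ‖u (w.step δ)‖) ^ 2 := by
        positivity
      rw [h4]
      linarith
    · simp
  have hsum : ∑ δ : G.Dart, P δ = ∑' w : G.Cover o,
      (∑ δ : G.Dart, if G.src δ = w.proj then w.stepWeight q δ else 0) * ‖u w‖ ^ 2 := by
    rw [← Summable.tsum_finsetSum fun δ _ => hP δ]
    refine tsum_congr fun w => ?_
    simp only [Finset.sum_mul, ite_mul, zero_mul]
  have hmain : 2 * ∑ δ : G.Dart, cross u δ ≤ 2 * ∑ δ : G.Dart, P δ := by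
    rw [Finset.mul_sum, two_mul]
    nth_rw 3 [← sum_rev]
    rw [← Finset.sum_add_distrib]
    exact Finset.sum_le_sum fun δ _ => hcross δ
  have hnonneg : ∀ w : G.Cover o,
      0 ≤ ∑ δ : G.Dart, if G.src δ = w.proj then w.stepWeight q δ else 0 := fun w =>
    Finset.sum_nonneg fun δ _ => by
      split_ifs
      · exact (w.stepWeight_pos hq0 δ).le
      · exact le_rfl
  have hbound : ∀ w : G.Cover o,
      (∑ δ : G.Dart, if G.src δ = w.proj then w.stepWeight q δ else 0) * ‖u w‖ ^ 2 ≤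
        2 * q * ‖u w‖ ^ 2 := fun w => by
    gcongr
    exact w.sum_stepWeight_le hd hdeg hq0 hqd
  calc ∑ δ : G.Dart, cross u δ ≤ ∑ δ : G.Dart, P δ := by linarith
    _ ≤ 2 * q * ∑' w, ‖u w‖ ^ 2 := by
      rw [hsum, ← tsum_mul_left]
      refine Summable.tsum_le_tsum hbound ?_ (hu.mul_left _)
      exact Summable.of_nonneg_of_le (fun w => mul_nonneg (hnonneg w) (by positivity)) hbound
        (hu.mul_left _)

/-! ### Spheres and radial test functions -/

/-- A reduced walk of length $n+1$ is uniquely a reduced walk of length $n$ with one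
non-backtracking edge appended. -/
theorem card_sphere_succ (n : ℕ) :
    (G.sphere o (n + 1)).card = ∑ w ∈ G.sphere o n, w.ahead.card := by
  rw [← Finset.card_sigma]
  symm
  have hwalk : ∀ p ∈ (G.sphere o n).sigma fun w => w.ahead,
      (p.1.step p.2).walk = p.2 :: p.1.walk := fun p hp => by
    have h := (p.1.mem_ahead p.2).1 (Finset.mem_sigma.1 hp).2
    exact p.1.walk_step_of_head_ne p.2 h.1 h.2
  refine Finset.card_bij (fun p _ => p.1.step p.2) (fun p hp => ?_) (fun p hp p' hp' h => ?_)
    fun w hw => ?_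
  · rw [mem_sphere, hwalk p hp, List.length_cons, mem_sphere.1 (Finset.mem_sigma.1 hp).1]
  · have h1 := congrArg Cover.walk h
    rw [hwalk p hp, hwalk p' hp', List.cons.injEq] at h1
    obtain ⟨w, δ⟩ := p
    obtain ⟨w', δ'⟩ := p'
    obtain rfl : w = w' := Cover.ext h1.2
    obtain rfl : δ = δ' := h1.1
    rfl
  · obtain ⟨l, hl⟩ := w
    cases l with
    | nil => simp [mem_sphere] at hw
    | cons δ l =>
      have hmem : (⟨⟨l, hl.2.2⟩, δ⟩ : Σ _ : G.Cover o, G.Dart) ∈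
          (G.sphere o n).sigma fun w => w.ahead := by
        rw [Finset.mem_sigma, mem_sphere, Cover.mem_ahead]
        exact ⟨by simpa [mem_sphere] using hw, hl.1, hl.2.1⟩
      exact ⟨_, hmem, Cover.ext (hwalk _ hmem)⟩

theorem card_sphere_succ_eq {d : ℕ} (hdeg : ∀ v, G.degree v = d) (n : ℕ) :
    (G.sphere o (n + 1)).card = d * (d - 1) ^ n := by
  induction n with
  | zero =>
    rw [card_sphere_succ, Finset.sum_congr rfl fun w hw => w.card_ahead_of_eq_nil hdeg
      (List.length_eq_zero_iff.1 (mem_sphere.1 hw)), Finset.sum_const, card_sphere_zero]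
    simp
  | succ n ih =>
    have h : ∀ w ∈ G.sphere o (n + 1), w.ahead.card = d - 1 := fun w hw =>
      Nat.eq_sub_of_add_eq (w.card_ahead_of_ne_nil hdeg
        (List.ne_nil_of_length_eq_add_one (mem_sphere.1 hw)))
    rw [card_sphere_succ, Finset.sum_congr rfl h, Finset.sum_const, ih, smul_eq_mul, pow_succ,
      mul_assoc]

/-- The factor 2 absorbs $d\le2(d-1)$ and treats the root like the other vertices. -/
theorem card_sphere_bounds {d : ℕ} (hd : 2 ≤ d) (hdeg : ∀ v, G.degree v = d) (n : ℕ) :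
    ((d : ℝ) - 1) ^ n ≤ (G.sphere o n).card ∧
      ((G.sphere o n).card : ℝ) ≤ 2 * ((d : ℝ) - 1) ^ n := by
  have h2 : (2 : ℝ) ≤ d := by exact_mod_cast hd
  cases n with
  | zero => simp [card_sphere_zero]
  | succ n =>
    have h3 : 0 < ((d : ℝ) - 1) ^ n := pow_pos (by linarith) n
    rw [card_sphere_succ_eq hdeg, Nat.cast_mul, Nat.cast_pow,
      Nat.cast_sub (by lia : 1 ≤ d), Nat.cast_one, pow_succ]
    constructor <;> nlinarith

/-- The decay $q^{-2k}$ balances the growth $(d-1)^k$ of the sphere. -/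
theorem sum_sphere_radial_sq_bounds {d : ℕ} (hd : 2 ≤ d) (hdeg : ∀ v, G.degree v = d) {q : ℝ}
    (hq : 0 < q) (hqd : q ^ 2 = d - 1) {n k : ℕ} (hk : k ≤ n) :
    1 ≤ ∑ w ∈ G.sphere o k, radial G o q n w ^ 2 ∧
      ∑ w ∈ G.sphere o k, radial G o q n w ^ 2 ≤ 2 := by
  have h := card_sphere_bounds (o := o) hd hdeg k
  rw [← hqd] at h
  have hpos : 0 < (q ^ 2) ^ k := by positivity
  rw [sum_sphere_radial_sq hk, ← div_eq_mul_inv, le_div_iff₀ hpos, div_le_iff₀ hpos, one_mul]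
  exact h

theorem le_sum_ball_radial_sq {d : ℕ} (hd : 2 ≤ d) (hdeg : ∀ v, G.degree v = d) {q : ℝ}
    (hq : 0 < q) (hqd : q ^ 2 = d - 1) (n : ℕ) :
    (n : ℝ) ≤ ∑ w ∈ G.ball o n, radial G o q n w ^ 2 := by
  rw [ball, Finset.sum_disjiUnion]
  calc (n : ℝ) ≤ ∑ _k ∈ Finset.range (n + 1), (1 : ℝ) := by simp
    _ ≤ _ := Finset.sum_le_sum fun k hk => (sum_sphere_radial_sq_bounds hd hdeg hq hqd
      (Nat.lt_succ_iff.1 (Finset.mem_range.1 hk))).1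

/-- The radial functions nearly attain the bound `2 √(d - 1)` of the adjacency form. -/
theorem le_sum_cross_radial {d : ℕ} (hd : 2 ≤ d) (hdeg : ∀ v, G.degree v = d) {q : ℝ}
    (hq : 0 < q) (hqd : q ^ 2 = d - 1) (n : ℕ) :
    2 * q * (∑ w ∈ G.ball o n, radial G o q n w ^ 2 - 4) ≤
      ∑ δ : G.Dart, cross (fun w => (radial G o q n w : ℂ)) δ := by
  have hcross : ∀ δ : G.Dart, cross (fun w => (radial G o q n w : ℂ)) δ =
      ∑ w ∈ G.ball o n, if G.src δ = w.proj then
        radial G o q n w * radial G o q n (w.step δ) else 0 := fun δ => by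
    rw [cross, tsum_eq_sum (s := G.ball o n)]
    · refine Finset.sum_congr rfl fun w _ => ?_
      simp [mul_comm]
    · intro w hw
      simp [radial_of_notMem_ball hw]
  have hnn := radial_nonneg (G := G) (o := o) hq.le n
  -- Strictly between root and outer sphere the radial function satisfies the eigenvalue equation
  -- with $2q$. Elsewhere nonnegativity suffices; the two discarded spheres have mass at most 2
  -- each, whence the 4.
  have hlocal : ∀ w ∈ G.ball o n,
      2 * q * (radial G o q n w ^ 2 - (if w.walk.length = 0 then radial G o q n w ^ 2 else 0)
        - (if w.walk.length = n then radial G o q n w ^ 2 else 0)) ≤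
      ∑ δ : G.Dart, if G.src δ = w.proj then
        radial G o q n w * radial G o q n (w.step δ) else 0 := fun w hw => by
    have hpos : 0 ≤ ∑ δ : G.Dart, (if G.src δ = w.proj then
        radial G o q n w * radial G o q n (w.step δ) else 0) :=
      Finset.sum_nonneg fun δ _ => by
        split_ifs
        · exact mul_nonneg (hnn _) (hnn _)
        · exact le_rfl
    have hneg : ∀ x y : ℝ, 0 ≤ y → x ≤ 0 → 2 * q * (x - y) ≤ 0 := fun x y hy hx =>
      mul_nonpos_of_nonneg_of_nonpos (by positivity) (by linarith)
    by_cases h0 : w.walk.length = 0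
    -- When $n=0$ the root is also the outer sphere and is subtracted twice, which only helps.
    · refine (hneg _ _ ?_ ?_).trans hpos
      · split_ifs <;> positivity
      · rw [if_pos h0, sub_self]
    by_cases hn : w.walk.length = n
    · refine le_trans ?_ hpos
      rw [if_neg h0, if_pos hn, sub_zero, sub_self, mul_zero]
    have hw0 : w.walk ≠ [] := fun h => h0 (by simp [h])
    have hwn : w.walk.length < n := lt_of_le_of_ne (mem_ball.1 hw) hn
    rw [if_neg h0, if_neg hn, sub_zero, sub_zero,
      ← w.sum_stepWeight_of_ne_nil hdeg hq.ne' hqd hw0, Finset.sum_mul]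
    refine Finset.sum_le_sum fun δ _ => ?_
    split_ifs with h
    · rw [radial_step hq.ne' w δ h hwn]
      exact le_of_eq (by ring)
    · simp
  have hsphere : ∀ k ≤ n, (∑ w ∈ G.ball o n, if w.walk.length = k then
      radial G o q n w ^ 2 else 0) ≤ 2 := fun k hk => by
    rw [← Finset.sum_filter]
    have : (G.ball o n).filter (·.walk.length = k) = G.sphere o k := by
      ext w
      simp only [Finset.mem_filter, mem_ball, mem_sphere]
      lia
    rw [this]
    exact (sum_sphere_radial_sq_bounds hd hdeg hq hqd hk).2
  rw [Finset.sum_congr rfl fun δ _ => hcross δ, Finset.sum_comm]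
  refine le_trans ?_ (Finset.sum_le_sum hlocal)
  rw [← Finset.mul_sum, Finset.sum_sub_distrib, Finset.sum_sub_distrib]
  have h0 := hsphere 0 n.zero_le
  have hn := hsphere n le_rfl
  exact mul_le_mul_of_nonneg_left (by linarith) (by positivity)

theorem half_sum_dirichlet {d : ℕ} (hdeg : ∀ v, G.degree v = d)
    (hu : Summable fun w => ‖u w‖ ^ 2) :
    (∑ δ : G.Dart, dirichlet u δ) / 2 = d * (∑' w, ‖u w‖ ^ 2) - ∑ δ : G.Dart, cross u δ := by
  have h := sum_mul_cross hu fun _ => 1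
  have h1 : ∀ w : G.Cover o, (∑ δ : G.Dart, if G.src δ = w.proj then (1 : ℝ) else 0) = d :=
    fun w => by
      rw [Finset.sum_boole, ← hdeg w.proj]
      rfl
  simp only [one_mul, h1, tsum_mul_left] at h
  linarith

/-! ### Self-adjointness and quadratic form of the lift -/

instance : Nonempty (G.Cover o) := ⟨⟨[], trivial⟩⟩

variable [Fintype V]

theorem isSelfAdjoint_jacobiLift (a : E → ℝ) (b : V → ℝ) :
    IsSelfAdjoint (G.jacobiLift a b o) := by
  rw [ContinuousLinearMap.isSelfAdjoint_iff_isSymmetric]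
  intro f g
  simp only [ContinuousLinearMap.coe_coe, jacobiLift, add_apply, sum_apply, inner_add_left,
    inner_add_right, sum_inner, inner_sum, inner_hop_left]
  rw [sum_rev fun δ => inner ℂ f (G.hop a o δ g)]
  congr 1
  rw [lp.inner_eq_tsum, lp.inner_eq_tsum]
  refine tsum_congr fun w => ?_
  simp only [weightedComp_apply, RCLike.inner_apply, map_mul, Complex.conj_ofReal, id]
  ring

theorem re_inner_jacobiLift (a : E → ℝ) (b : V → ℝ) (f : lp (fun _ : G.Cover o => ℂ) 2) :
    (inner ℂ f (G.jacobiLift a b o f)).re =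
      (∑' w : G.Cover o, b w.proj * ‖f w‖ ^ 2) + ∑ δ : G.Dart, a δ.1 * cross f δ := by
  simp only [jacobiLift, add_apply, sum_apply, inner_add_right, inner_sum, Complex.add_re,
    Complex.re_sum]
  congr 1
  · rw [lp.inner_eq_tsum, Complex.re_tsum (lp.summable_inner _ _)]
    refine tsum_congr fun w => ?_
    simp only [weightedComp_apply, id]
    rw [← smul_eq_mul, inner_smul_right, Complex.re_ofReal_mul,
      ← RCLike.re_eq_complex_re, inner_self_eq_norm_sq]
  · refine Finset.sum_congr rfl fun δ _ => ?_
    rw [lp.inner_eq_tsum, Complex.re_tsum (lp.summable_inner _ _), cross, ← tsum_mul_left]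
    refine tsum_congr fun w => ?_
    rw [hop_apply]
    split_ifs
    · rw [← smul_eq_mul, inner_smul_right, Complex.re_ofReal_mul]
    · simp

/-! ### The ground state representation -/

/-- The weights at a vertex sum to $(\sigma-b)\psi^2$, so adding the potential term $b\psi^2|u|^2$
leaves $\sigma|f|^2$; the rest is the Dirichlet form. -/
theorem re_inner_jacobiLift_eq {a : E → ℝ} {b ψ : V → ℝ} {σ : ℝ}
    (h : G.jacobiMatrix a b *ᵥ ψ = σ • ψ) {f : lp (fun _ : G.Cover o => ℂ) 2}
    (hfu : ∀ w, f w = (ψ w.proj : ℂ) * u w) (hu : Summable fun w => ‖u w‖ ^ 2) :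
    (inner ℂ f (G.jacobiLift a b o f)).re =
      σ * ‖f‖ ^ 2 - (∑ δ : G.Dart, G.edgeWeight a ψ δ.1 * dirichlet u δ) / 2 := by
  have hb : Summable fun w : G.Cover o => b w.proj * ‖f w‖ ^ 2 := by
    refine Summable.of_norm_bounded ((summable_norm_sq f).mul_left (∑ v, |b v|)) fun w => ?_
    rw [norm_mul, Real.norm_eq_abs, Real.norm_of_nonneg (by positivity)]
    gcongr
    exact Finset.single_le_sum (f := fun v => |b v|) (fun v _ => abs_nonneg _)
      (Finset.mem_univ w.proj)
  rw [re_inner_jacobiLift]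
  simp only [mul_cross_eq a ψ hfu]
  rw [sum_mul_cross hu, norm_sq_eq_tsum, ← tsum_mul_left, ← add_sub_assoc]
  congr 1
  rw [← eq_sub_iff_add_eq', ← ((summable_norm_sq f).mul_left σ).tsum_sub hb]
  refine tsum_congr fun w => ?_
  rw [sum_edgeWeight h, hfu, norm_mul, Complex.norm_real, mul_pow, Real.norm_eq_abs, sq_abs]
  ring

/-! ### Comparison of the gap with that of the regular tree -/

theorem nontrivial_lp {W : Type*} [Nonempty W] : Nontrivial (lp (fun _ : W => ℂ) 2) := by
  classical
  obtain ⟨w⟩ := ‹Nonempty W›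
  refine ⟨lp.single 2 w 1, 0, fun h => ?_⟩
  have := congrArg (fun f : lp (fun _ : W => ℂ) 2 => f w) h
  simp at this

/-- Every $f$ is $\psi u$ with $u\in\ell^2$, since $\psi$ takes finitely many positive values. Then
`μ` bounds the edge weights below, and `ν` compares $\|f\|^2$ with $\|u\|^2$. -/
theorem mul_le_gap {d : ℕ} (hd : 2 ≤ d) (hdeg : ∀ v, G.degree v = d) {a : E → ℝ} {b ψ : V → ℝ}
    (hψpos : ∀ i, 0 < ψ i) (hψ : G.jacobiMatrix a b *ᵥ ψ = G.topEigenvalue a b • ψ)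
    {μ ν : ℝ} (hμ0 : 0 ≤ μ) (hμ : ∀ e, μ ≤ G.edgeWeight a ψ e) (hν : ∀ i, ν * ψ i ^ 2 ≤ 1) :
    ν * μ * ((d : ℝ) - 2 * √((d : ℝ) - 1)) ≤ G.gap a b o := by
  have hd' : (2 : ℝ) ≤ d := by exact_mod_cast hd
  have hqd : √((d : ℝ) - 1) ^ 2 = d - 1 := Real.sq_sqrt (by linarith)
  have hq : 1 ≤ √((d : ℝ) - 1) := Real.one_le_sqrt.2 (by linarith)
  set q := √((d : ℝ) - 1)
  -- Indeed $d-2q=(q-1)^2$.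
  have hg : 0 ≤ (d : ℝ) - 2 * q := by nlinarith [sq_nonneg (q - 1)]
  have := nontrivial_lp (W := G.Cover o)
  rw [gap, le_sub_comm]
  refine (isSelfAdjoint_jacobiLift a b).sSup_spectrum_le fun f => ?_
  let u : G.Cover o → ℂ := fun w => (ψ w.proj : ℂ)⁻¹ * f w
  have hfu : ∀ w, f w = (ψ w.proj : ℂ) * u w := fun w =>
    (mul_inv_cancel_left₀ (Complex.ofReal_ne_zero.2 (hψpos w.proj).ne') _).symm
  have hnorm : ∀ w, ‖u w‖ ^ 2 = (ψ w.proj ^ 2)⁻¹ * ‖f w‖ ^ 2 := fun w => by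
    simp [u, mul_pow, abs_of_pos (hψpos w.proj)]
  have hu : Summable fun w => ‖u w‖ ^ 2 := by
    refine Summable.of_nonneg_of_le (fun w => by positivity) (fun w => ?_)
      ((summable_norm_sq f).mul_left (∑ v, (ψ v ^ 2)⁻¹))
    rw [hnorm]
    gcongr
    exact Finset.single_le_sum (f := fun v => (ψ v ^ 2)⁻¹) (fun v _ => by positivity)
      (Finset.mem_univ w.proj)
  have hU : ν * ‖f‖ ^ 2 ≤ ∑' w, ‖u w‖ ^ 2 := by
    rw [norm_sq_eq_tsum, ← tsum_mul_left]
    refine ((summable_norm_sq f).mul_left ν).tsum_le_tsum (fun w => ?_) hu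
    rw [hnorm]
    gcongr
    rw [← one_div, le_div_iff₀ (pow_pos (hψpos _) 2)]
    exact hν _
  have hD : μ * ∑ δ : G.Dart, dirichlet u δ ≤
      ∑ δ : G.Dart, G.edgeWeight a ψ δ.1 * dirichlet u δ := by
    rw [Finset.mul_sum]
    exact Finset.sum_le_sum fun δ _ => mul_le_mul_of_nonneg_right (hμ _) (dirichlet_nonneg u δ)
  have h1 := half_sum_dirichlet hdeg hu
  have h2 := sum_cross_le hd hdeg hq hqd hu
  rw [re_inner_jacobiLift_eq hψ hfu hu]
  have h3 : μ * (((d : ℝ) - 2 * q) * (ν * ‖f‖ ^ 2)) ≤ μ * ((∑ δ : G.Dart, dirichlet u δ) / 2) := by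
    refine mul_le_mul_of_nonneg_left ?_ hμ0
    have := mul_le_mul_of_nonneg_left hU hg
    linarith
  linarith

/-- Tests the Rayleigh quotient on $\psi$ times truncated radial functions. Nonnegativity of the gap
is what allows $\|f\|^2$ to be replaced by its lower bound $I\|u\|^2$. -/
theorem mul_gap_le {d : ℕ} (hd : 2 ≤ d) (hdeg : ∀ v, G.degree v = d) {a : E → ℝ} {b ψ : V → ℝ}
    (hψ : G.jacobiMatrix a b *ᵥ ψ = G.topEigenvalue a b • ψ) (hgap : 0 ≤ G.gap a b o)
    {S I : ℝ} (hS0 : 0 ≤ S) (hS : ∀ e, G.edgeWeight a ψ e ≤ S) (hI : ∀ i, I ≤ ψ i ^ 2) :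
    I * G.gap a b o ≤ S * ((d : ℝ) - 2 * √((d : ℝ) - 1)) := by
  have hd' : (2 : ℝ) ≤ d := by exact_mod_cast hd
  have hqd : √((d : ℝ) - 1) ^ 2 = d - 1 := Real.sq_sqrt (by linarith)
  have hq : 0 < √((d : ℝ) - 1) := Real.sqrt_pos.2 (by linarith)
  set q := √((d : ℝ) - 1)
  have := nontrivial_lp (W := G.Cover o)
  -- The right side is $S$ times the truncation loss $2q\cdot4$, independent of $n$, while the sum
  -- on the left is at least $n$.
  have key : ∀ n : ℕ, (I * G.gap a b o - S * ((d : ℝ) - 2 * q)) *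
      ∑ w ∈ G.ball o n, radial G o q n w ^ 2 ≤ 8 * q * S := fun n => by
    let u : G.Cover o → ℂ := fun w => (radial G o q n w : ℂ)
    have hu0 : ∀ w ∉ G.ball o n, u w = 0 := fun w hw => by
      simp [u, radial_of_notMem_ball hw]
    have hu : Summable fun w => ‖u w‖ ^ 2 :=
      summable_of_ne_finset_zero (s := G.ball o n) fun w hw => by simp [hu0 w hw]
    have hU : ∑' w, ‖u w‖ ^ 2 = ∑ w ∈ G.ball o n, radial G o q n w ^ 2 := by
      rw [tsum_eq_sum (s := G.ball o n) fun w hw => by simp [hu0 w hw]]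
      simp [u]
    let f : lp (fun _ : G.Cover o => ℂ) 2 := ⟨fun w => (ψ w.proj : ℂ) * u w,
      memℓp_gen (summable_of_ne_finset_zero (s := G.ball o n) fun w hw => by simp [hu0 w hw])⟩
    have hfu : ∀ w, f w = (ψ w.proj : ℂ) * u w := fun w => rfl
    have hIU : I * ∑' w, ‖u w‖ ^ 2 ≤ ‖f‖ ^ 2 := by
      rw [norm_sq_eq_tsum, ← tsum_mul_left]
      refine (hu.mul_left I).tsum_le_tsum (fun w => ?_) (summable_norm_sq f)
      rw [hfu, norm_mul, mul_pow, Complex.norm_real (ψ w.proj), Real.norm_eq_abs (ψ w.proj), sq_abs]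
      exact mul_le_mul_of_nonneg_right (hI _) (by positivity)
    have hD : ∑ δ : G.Dart, G.edgeWeight a ψ δ.1 * dirichlet u δ ≤
        S * ∑ δ : G.Dart, dirichlet u δ := by
      rw [Finset.mul_sum]
      exact Finset.sum_le_sum fun δ _ => mul_le_mul_of_nonneg_right (hS _) (dirichlet_nonneg u δ)
    have h1 := half_sum_dirichlet hdeg hu
    have h2 := le_sum_cross_radial (o := o) hd hdeg hq hqd n
    have h3 := (isSelfAdjoint_jacobiLift (o := o) a b).re_inner_le_sSup_spectrum f
    rw [re_inner_jacobiLift_eq hψ hfu hu] at h3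
    have h4 : G.gap a b o * ‖f‖ ^ 2 ≤ S * ((∑ δ : G.Dart, dirichlet u δ) / 2) := by
      rw [gap, topSpectrum]
      linarith
    have h5 := mul_le_mul_of_nonneg_left hIU hgap
    rw [hU] at h1 h5
    have h6 := mul_le_mul_of_nonneg_left h2 hS0
    rw [h1] at h4
    linarith
  by_contra! hlt
  obtain ⟨n, hn⟩ := exists_nat_gt (8 * q * S / (I * G.gap a b o - S * ((d : ℝ) - 2 * q)))
  rw [div_lt_iff₀ (sub_pos.2 hlt)] at hn
  have h := mul_le_mul_of_nonneg_left (le_sum_ball_radial_sq (o := o) hd hdeg hq hqd n)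
    (sub_pos.2 hlt).le
  linarith [key n]

end Multigraph

theorem corollary2p4 {V E : Type*} [Fintype V] [Fintype E] [DecidableEq V] [DecidableEq E]
    (G : Multigraph V E) (hconn : G.Connected) (d : ℕ) (hd : 2 ≤ d)
    (hdeg : ∀ v, G.degree v = d)
    (a : E → ℝ) (ha : ∀ e, 0 < a e) (b : V → ℝ)
    (ψ : V → ℝ) (hψpos : ∀ i, 0 < ψ i)
    (hψ : G.jacobiMatrix a b *ᵥ ψ = G.topEigenvalue a b • ψ)
    (o : V) :
    G.vertexInfInv ψ / G.edgeSupInv a ψ * ((d : ℝ) - 2 * √((d : ℝ) - 1)) ≤ G.gap a b o ∧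
      G.gap a b o ≤ G.edgeSup a ψ / G.vertexInf ψ * ((d : ℝ) - 2 * √((d : ℝ) - 1)) := by
  have : Nonempty V := ⟨o⟩
  have hw : ∀ e, 0 < G.edgeWeight a ψ e := fun e =>
    mul_pos (mul_pos (ha e) (hψpos _)) (hψpos _)
  -- A positive degree yields an edge, so the suprema over `E` are genuine and positive.
  have hne : Nonempty E := by
    have h : 0 < (Finset.univ.filter fun δ : G.Dart => G.src δ = o).card := by
      have : (Finset.univ.filter fun δ : G.Dart => G.src δ = o).card = d := hdeg o
      lia
    obtain ⟨δ, -⟩ := Finset.card_pos.1 h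
    exact ⟨δ.1⟩
  have hSinv : ∀ e, 1 / G.edgeWeight a ψ e ≤ G.edgeSupInv a ψ := fun e =>
    le_ciSup (f := fun e => 1 / G.edgeWeight a ψ e) (Set.finite_range _).bddAbove e
  have hS : ∀ e, G.edgeWeight a ψ e ≤ G.edgeSup a ψ := fun e =>
    le_ciSup (f := fun e => G.edgeWeight a ψ e) (Set.finite_range _).bddAbove e
  have hIinv : ∀ i, G.vertexInfInv ψ ≤ 1 / ψ i ^ 2 := fun i =>
    ciInf_le (Set.finite_range _).bddBelow i
  have hI : ∀ i, G.vertexInf ψ ≤ ψ i ^ 2 := fun i => ciInf_le (Set.finite_range _).bddBelow i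
  have hSinv0 : 0 < G.edgeSupInv a ψ :=
    hne.elim fun e => (one_div_pos.2 (hw e)).trans_le (hSinv e)
  have hS0 : 0 ≤ G.edgeSup a ψ := hne.elim fun e => (hw e).le.trans (hS e)
  have hI0 : 0 < G.vertexInf ψ := by
    obtain ⟨i, hi⟩ := exists_eq_ciInf_of_finite (f := fun i => ψ i ^ 2)
    rw [Multigraph.vertexInf, ← hi]
    exact pow_pos (hψpos i) 2
  have hIinv0 : 0 ≤ G.vertexInfInv ψ := le_ciInf fun i => by positivity
  have hlow : G.vertexInfInv ψ / G.edgeSupInv a ψ * ((d : ℝ) - 2 * √((d : ℝ) - 1)) ≤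
      G.gap a b o := by
    rw [div_eq_mul_inv]
    -- Here $\mu=1/\tilde S$ and $\nu=\tilde I$.
    refine Multigraph.mul_le_gap hd hdeg hψpos hψ (inv_nonneg.2 hSinv0.le) (fun e => ?_)
      fun i => (le_div_iff₀ (pow_pos (hψpos i) 2)).1 (hIinv i)
    rw [inv_le_comm₀ hSinv0 (hw e), ← one_div]
    exact hSinv e
  have hg : 0 ≤ (d : ℝ) - 2 * √((d : ℝ) - 1) := by
    have hd' : (2 : ℝ) ≤ d := by exact_mod_cast hd
    nlinarith [sq_nonneg (√((d : ℝ) - 1) - 1), Real.sq_sqrt (show 0 ≤ (d : ℝ) - 1 by linarith)]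
  refine ⟨hlow, ?_⟩
  -- The lower bound supplies the sign needed for the upper bound.
  have hgap : 0 ≤ G.gap a b o :=
    (mul_nonneg (div_nonneg hIinv0 hSinv0.le) hg).trans hlow
  rw [div_mul_eq_mul_div, le_div_iff₀ hI0, mul_comm]
  exact Multigraph.mul_gap_le hd hdeg hψ hgap hS0 hS hI
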